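/- Call a function $f:A\to\mathbb C$ on an abelian group $A$ *positive-definite* if for all $x_1,\dots,x_n\in A$ the matrix $(f(x_j-x_i))_{i,j}$ is Hermitian and nonnegative-definite. For a topological abelian group $A$ and a continuous, even, positive-definite function $u:A\to(0,\infty)$ with $u(0)=1$, the *ghost-space (of the first kind)* $A_u$ is $A$ together with the convolution of point measures $\delta_x*\delta_y=\frac{u(x)u(y)}{u(x+y)}\,\delta_{x+y}$. **Proposition 3.2.** Let $G$ be a locally compact abelian group, $H$ a closed subgroup, and $u:G\to(0,\infty)$ a continuous, even, positive-definite function with $u(0)=1$. Let $m_G$, $m_H$ be Haar measures on $G$, $H$, and suppose that $\int_G u\,dm_G$ and $\int_H u\,dm_H$ are both finite. Then $\int_H u(x+y)\,dm_H(y)$ is finite for every $x\in G$, so that $$v(x+H)=\frac{\int_H u(x+y)\,dm_H(y)}{\int_H u(y)\,dm_H(y)}$$ is a well-defined function on $G/H$. If $v$ is continuous, then $v$ is positive-definite, and moreover $v$ is positive and even with $v(0)=1$, so that $(G/H)_v$ is a ghost-space of the first kind (the quotient $G_u/H_u$). -/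

import Mathlib

open MeasureTheory
open scoped ComplexOrder

/-- A complex-valued function `f` on an abelian group is positive-definite if for all
`x₁, …, xₙ` the matrix `f (x_j - x_i)` is Hermitian and nonnegative-definite. -/
def IsPositiveDefinite {A : Type*} [AddCommGroup A] (f : A → ℂ) : Prop :=
  ∀ (n : ℕ) (x : Fin n → A),
    (Matrix.of fun i j : Fin n => f (x j - x i)).PosSemidef

/-- A ghost-space (of the first kind) `A_u` on a topological abelian group `A`: the convolution of
Borel point measures `δ_x * δ_y = (u x * u y / u (x + y)) δ_{x + y}` attached to a positive,
positive-definite, even, continuous function `u` with `u 0 = 1`. -/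
structure GhostSpace (A : Type*) [AddCommGroup A] [TopologicalSpace A] where
  /-- the function `u` -/
  weight : A → ℝ
  continuous_weight : Continuous weight
  weight_pos : ∀ x, 0 < weight x
  weight_neg : ∀ x, weight (-x) = weight x
  weight_zero : weight 0 = 1
  posDef_weight : IsPositiveDefinite fun x => (weight x : ℂ)
  /-- the measure `δ_x * δ_y` -/
  conv : A → A → @Measure A (borel A)
  conv_eq : ∀ x y, conv x y =
    ENNReal.ofReal (weight x * weight y / weight (x + y)) • @Measure.dirac A (borel A) (x + y)

section Quotient

variable {G : Type*} [AddCommGroup G] [TopologicalSpace G] [IsTopologicalAddGroup G]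
  [MeasurableSpace G] [BorelSpace G]

/-- The integral of a function over `x + H` depends only on the coset of `x`. -/
theorem integral_coset_eq (H : AddSubgroup G) (m : Measure H) [m.IsAddHaarMeasure] (u : G → ℝ)
    {a b : G} (h : -a + b ∈ H) :
    ∫ y : H, u (a + y) ∂m = ∫ y : H, u (b + y) ∂m := by
  rw [← integral_add_left_eq_self (fun y : H => u (a + y)) ⟨-a + b, h⟩]
  congr 1
  funext y
  simp [← add_assoc]

/-- The function `v (x + H) = (∫_H u (x + y) dm y) / (∫_H u y dm y)` on `G ⧸ H`. -/
noncomputable def cosetAverage (H : AddSubgroup G) (m : Measure H) [m.IsAddHaarMeasure]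
    (u : G → ℝ) : G ⧸ H → ℝ :=
  Quotient.lift (fun x : G => (∫ y : H, u (x + y) ∂m) / ∫ y : H, u y ∂m) fun a b h => by
    have h' : -a + b ∈ H := QuotientAddGroup.leftRel_apply.mp h
    simp only [integral_coset_eq H m u h']

end Quotient

/-! A continuous positive-definite `u` is a Hilbert-space coefficient: `⟨e x, e y⟩ = u (y - x)` with
`e` continuous. Averaging `e` over Følner sets of `H` gives everything. These sets are sumsets `B ⊆
A = B + K` of a compact neighbourhood `K` of `0`; polynomial growth makes `m A / m B` as close to
`1` as desired. Finiteness (`setIntegral_le_of_inner`): Cauchy–Schwarz for `∫_A e h` and `∫_A e (x +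
h)` bounds `m B * ∫_K u (x + y)` by `m A * ∫_H u`, whence a bound uniform in `K`. Positivity
(`integral_nonneg_of_inner`): with `φ h = ∑ c i • e (x i + h)`, the numbers `‖∫_A φ‖² / m A ≥ 0`
approximate the quadratic form of the coset integrals. The sets `K` must exhaust `H`, which is
σ-compact because it carries a positive continuous integrable function. -/

open Set Filter Topology
open scoped Pointwise

/-! ### Sumsets, polynomial growth and the Følner condition -/

/-- The `(n + 1)`-fold sumset `K + ⋯ + K`. -/
def iteratedSum {X : Type*} [AddCommGroup X] (K : Set X) : ℕ → Set X
  | 0 => K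
  | n + 1 => iteratedSum K n + K

/-- If `K + K` is covered by the translates of `K` by a finite set `F`, then the `(n + 1)`-fold
sumset of `K` is covered by the translates by the `n`-fold sums from `F`. -/
theorem iteratedSum_subset {X : Type*} [AddCommGroup X] {K : Set X} (F : Finset X)
    (hF : K + K ⊆ K + (F : Set X)) (n : ℕ) :
    iteratedSum K n ⊆ ⋃ g : F → Fin (n + 1), (fun y => (∑ a : F, (g a : ℕ) • (a : X)) + y) '' K := by
  induction n with
  | zero =>
    intro x hx
    refine mem_iUnion.2 ⟨fun _ => 0, x, hx, ?_⟩
    simp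
  | succ n ih =>
    rintro _ ⟨x, hx, k, hk, rfl⟩
    obtain ⟨g, y, hy, rfl⟩ := mem_iUnion.1 (ih hx)
    obtain ⟨z, hz, f, hf, hzf⟩ := hF (add_mem_add hy hk)
    have hzf' : z + f = y + k := hzf
    classical
    refine mem_iUnion.2 ⟨fun a => if a = ⟨f, hf⟩ then (g a).succ else (g a).castSucc, z, hz, ?_⟩
    have : ∀ a : F, ((if a = ⟨f, hf⟩ then (g a).succ else (g a).castSucc : Fin (n + 2)) : ℕ)
        • (a : X) = (g a : ℕ) • (a : X) + if a = ⟨f, hf⟩ then (a : X) else 0 := by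
      intro a
      split_ifs with h
      · simp [add_smul]
      · simp
    simp only [this, Finset.sum_add_distrib, Finset.sum_ite_eq', Finset.mem_univ, if_true]
    rw [add_assoc, add_assoc, ← hzf', add_comm z f]

theorem iteratedSum_subset_succ {X : Type*} [AddCommGroup X] {K : Set X} (h0 : (0 : X) ∈ K) (n : ℕ) :
    iteratedSum K n ⊆ iteratedSum K (n + 1) := fun x hx => ⟨x, hx, 0, h0, add_zero x⟩

section Growth

variable {X : Type*} [AddCommGroup X] [TopologicalSpace X] [IsTopologicalAddGroup X]

theorem isCompact_iteratedSum {K : Set X} (hK : IsCompact K) (n : ℕ) :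
    IsCompact (iteratedSum K n) := by
  induction n with
  | zero => exact hK
  | succ n ih => exact ih.add hK

theorem isClosed_iteratedSum {K : Set X} (hK : IsCompact K) (hKc : IsClosed K) (n : ℕ) :
    IsClosed (iteratedSum K n) := by
  induction n with
  | zero => exact hKc
  | succ n ih => exact ih.add_right_of_isCompact hK

variable [MeasurableSpace X] (m : Measure X) [m.IsAddHaarMeasure]

theorem measure_iteratedSum_pos {K : Set X} (hK : IsCompact K) (hK0 : K ∈ 𝓝 (0 : X)) (n : ℕ) :
    0 < m.real (iteratedSum K n) := by
  have hsub : ∀ n, iteratedSum K n ∈ 𝓝 (0 : X) := by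
    intro n
    induction n with
    | zero => exact hK0
    | succ n ih => exact mem_of_superset ih (iteratedSum_subset_succ (mem_of_mem_nhds hK0) n)
  exact ENNReal.toReal_pos (Measure.measure_pos_of_mem_nhds m (hsub n)).ne'
    (isCompact_iteratedSum hK n).measure_ne_top

variable [BorelSpace X]

/-- The sumsets of a compact neighbourhood of `0` have polynomial growth. -/
theorem measure_iteratedSum_le {K : Set X} (hK : IsCompact K) (hK0 : K ∈ 𝓝 (0 : X)) :
    ∃ d : ℕ, ∀ n, m.real (iteratedSum K n) ≤ ((n : ℝ) + 1) ^ d * m.real K := by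
  obtain ⟨t, ht⟩ := compact_covered_by_add_left_translates (hK.add hK)
    (V := K) ⟨0, mem_interior_iff_mem_nhds.2 hK0⟩
  classical
  set F : Finset X := t.image Neg.neg with hF
  have hsub : K + K ⊆ K + (F : Set X) := by
    intro x hx
    obtain ⟨g, hg, hgx⟩ := mem_iUnion₂.1 (ht hx)
    refine ⟨g + x, hgx, -g, ?_, by simp⟩
    simp [hF, hg]
  -- There are `(n + 1) ^ |F|` functions `F → Fin (n + 1)`, hence that many translates of `K`.
  refine ⟨Fintype.card F, fun n => ?_⟩
  have hfin : ∀ n, m (iteratedSum K n) ≠ ⊤ := fun n => (isCompact_iteratedSum hK n).measure_ne_top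
  calc m.real (iteratedSum K n)
      ≤ m.real (⋃ g : F → Fin (n + 1), (fun y => (∑ a : F, (g a : ℕ) • (a : X)) + y) '' K) := by
        refine measureReal_mono (iteratedSum_subset F hsub n) ?_
        refine ((measure_iUnion_le _).trans_lt ?_).ne
        simp only [tsum_fintype, image_add_left, measure_preimage_add]
        exact ENNReal.sum_lt_top.2 fun _ _ => hK.measure_lt_top
    _ ≤ ∑ g : F → Fin (n + 1), m.real ((fun y => (∑ a : F, (g a : ℕ) • (a : X)) + y) '' K) :=
        measureReal_iUnion_fintype_le _
    _ = _ := by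
        simp only [image_add_left, measureReal_def, measure_preimage_add]
        simp

/-- A Følner condition for the sumsets of a compact neighbourhood of `0`. -/
theorem exists_measure_iteratedSum_succ_le {K : Set X} (hK : IsCompact K) (hK0 : K ∈ 𝓝 (0 : X))
    {ε : ℝ} (hε : 0 < ε) :
    ∃ n, m.real (iteratedSum K (n + 1)) ≤ (1 + ε) * m.real (iteratedSum K n) := by
  by_contra! h
  obtain ⟨d, hd⟩ := measure_iteratedSum_le m hK hK0
  have hpos : 0 < m.real K :=
    ENNReal.toReal_pos (Measure.measure_pos_of_mem_nhds m hK0).ne' hK.measure_ne_top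
  have hexp : ∀ n, (1 + ε) ^ n * m.real K ≤ m.real (iteratedSum K n) := by
    intro n
    induction n with
    | zero => simp [iteratedSum]
    | succ n ih =>
      rw [pow_succ', mul_assoc]
      exact (mul_le_mul_of_nonneg_left ih (by positivity)).trans (h n).le
  have hle : ∀ n : ℕ, (1 + ε) ^ n ≤ ((n : ℝ) + 1) ^ d := fun n =>
    le_of_mul_le_mul_right ((hexp n).trans (hd n)) hpos
  have hlim := tendsto_pow_const_div_const_pow_of_one_lt d (r := 1 + ε) (by linarith)
  -- The shift by one and the threshold `1 / (1 + ε)` give `(n + 1) ^ d < (1 + ε) ^ n`,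
  -- contradicting `hle`.
  have hlim' := (tendsto_add_atTop_iff_nat 1).2 hlim
  obtain ⟨n, hn⟩ := (hlim'.eventually
    (gt_mem_nhds (show (0 : ℝ) < 1 / (1 + ε) by positivity))).exists
  have h1 : (0 : ℝ) < 1 + ε := by positivity
  rw [div_lt_div_iff₀ (by positivity) h1, pow_succ] at hn
  push_cast at hn
  have := hle n
  nlinarith

end Growth

/-! ### Positive-definite functions as Hilbert-space coefficients -/

theorem IsPositiveDefinite.star_apply {A : Type*} [AddCommGroup A] {f : A → ℂ}
    (hf : IsPositiveDefinite f) (x : A) : star (f x) = f (-x) := by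
  simpa using (hf 2 ![x, 0]).1.apply 0 1

theorem IsPositiveDefinite.sum_nonneg {A : Type*} [AddCommGroup A] {f : A → ℂ}
    (hf : IsPositiveDefinite f) (s : Finset A) (c : A → ℂ) :
    0 ≤ ∑ x ∈ s, ∑ y ∈ s, star (c x) * f (y - x) * c y := by
  have h := (hf s.card fun i => (s.equivFin.symm i : A)).dotProduct_mulVec_nonneg
    fun i => c (s.equivFin.symm i)
  rw [← Finset.sum_coe_sort s]
  simp_rw [← Finset.sum_coe_sort s (fun y => _ * f (y - _) * c y)]
  rw [← Equiv.sum_comp s.equivFin.symm]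
  simp_rw [← Equiv.sum_comp s.equivFin.symm (fun y : s => _ * f (y - _) * c y)]
  simpa [dotProduct, Matrix.mulVec, Finset.mul_sum, mul_assoc] using h

/-- A continuous positive-definite function is a coefficient of a continuous map to a
Hilbert space. -/
theorem IsPositiveDefinite.exists_continuous_inner.{v} {A : Type v} [AddCommGroup A]
    [TopologicalSpace A] [IsTopologicalAddGroup A] {f : A → ℂ} (hf : IsPositiveDefinite f)
    (hfc : Continuous f) :
    ∃ (E : Type v) (_ : NormedAddCommGroup E) (_ : InnerProductSpace ℂ E)
      (_ : CompleteSpace E) (e : A → E), Continuous e ∧ ∀ x y, inner ℂ (e x) (e y) = f (y - x) := by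
  set K : Matrix A A (ℂ →L[ℂ] ℂ) := Matrix.of fun x y => f (y - x) • ContinuousLinearMap.id ℂ ℂ
    with hKdef
  have hherm (x : A) : starRingEnd ℂ (f x) = f (-x) := hf.star_apply x
  have hK : K.PosSemidef := by
    have hiff := (RKHS.posSemidef_tfae (𝕜 := ℂ) (K := K)).out 0 2
    refine hiff.2 ⟨?_, fun vv => ?_⟩
    · ext x y
      simp [hKdef, Matrix.conjTranspose_apply, ContinuousLinearMap.star_eq_adjoint, hherm,
        ContinuousLinearMap.adjoint_id]
    · have h := (Complex.le_def.1 (hf.sum_nonneg vv.support vv)).1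
      refine h.trans_eq ?_
      simp only [Finsupp.sum, RCLike.re_eq_complex_re]
      congr 1
      refine Finset.sum_congr rfl fun x _ => Finset.sum_congr rfl fun y _ => ?_
      simp [hKdef, hherm]
      ring
  have : Fact K.PosSemidef := ⟨hK⟩
  have hin : ∀ x y, inner ℂ (RKHS.kerFun (RKHS.OfKernel K) x (1 : ℂ))
      (RKHS.kerFun (RKHS.OfKernel K) y (1 : ℂ)) = f (y - x) := by
    intro x y
    rw [← RKHS.kernel_inner, RKHS.OfKernel.kernel_ofKernel]
    simp [hKdef, hherm]
  refine ⟨RKHS.OfKernel K, inferInstance, inferInstance, inferInstance,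
    fun x => RKHS.kerFun (RKHS.OfKernel K) x (1 : ℂ), ?_, hin⟩
  rw [continuous_iff_continuousAt]
  intro x
  rw [ContinuousAt, tendsto_iff_norm_sub_tendsto_zero]
  -- Expanding the square reduces continuity of the kernel sections to continuity of `f`.
  have hsq : ∀ y, ‖RKHS.kerFun (RKHS.OfKernel K) y (1 : ℂ) -
      RKHS.kerFun (RKHS.OfKernel K) x (1 : ℂ)‖ =
      Real.sqrt (2 * (f 0).re - 2 * (f (x - y)).re) := by
    intro y
    rw [← Real.sqrt_sq (norm_nonneg (RKHS.kerFun (RKHS.OfKernel K) y (1 : ℂ) -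
      RKHS.kerFun (RKHS.OfKernel K) x (1 : ℂ))), norm_sub_sq (𝕜 := ℂ), hin,
      ← inner_self_eq_norm_sq (𝕜 := ℂ), ← inner_self_eq_norm_sq (𝕜 := ℂ), hin, hin]
    simp only [sub_self, RCLike.re_eq_complex_re]
    congr 1
    ring
  simp only [hsq]
  have : Continuous fun y => Real.sqrt (2 * (f 0).re - 2 * (f (x - y)).re) := by fun_prop
  simpa using this.tendsto x

/-- Pulling the integrals out of the inner product one variable at a time yields the iterated
integral without Fubini. -/
theorem inner_setIntegral_setIntegral {X E : Type*} [TopologicalSpace X] [MeasurableSpace X]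
    [BorelSpace X] [NormedAddCommGroup E] [InnerProductSpace ℂ E] [CompleteSpace E]
    (m : Measure X) [IsFiniteMeasureOnCompacts m] {φ ψ : X → E} (hφ : Continuous φ)
    (hψ : Continuous ψ) {A : Set X} (hA : IsCompact A) (hAc : IsClosed A) :
    inner ℂ (∫ h in A, φ h ∂m) (∫ k in A, ψ k ∂m) = ∫ h in A, ∫ k in A, inner ℂ (φ h) (ψ k) ∂m ∂m
      ∧ IntegrableOn (fun h => ∫ k in A, inner ℂ (φ h) (ψ k) ∂m) A m := by
  have hφi : IntegrableOn φ A m := hφ.continuousOn.integrableOn_compact' hA hAc.measurableSet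
  have hψi : IntegrableOn ψ A m := hψ.continuousOn.integrableOn_compact' hA hAc.measurableSet
  have h1 : ∀ h, ∫ k in A, inner ℂ (φ h) (ψ k) ∂m = inner ℂ (φ h) (∫ k in A, ψ k ∂m) :=
    fun h => integral_inner hψi (φ h)
  simp only [h1]
  refine ⟨?_, ?_⟩
  · rw [← inner_conj_symm, ← integral_inner hφi, ← integral_conj]
    simp only [inner_conj_symm]
  · exact Continuous.continuousOn (by fun_prop) |>.integrableOn_compact' hA hAc.measurableSet

/-! ### σ-compactness and compact exhaustion -/

section SigmaCompact

variable {X : Type*} [AddCommGroup X] [TopologicalSpace X] [IsTopologicalAddGroup X]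
  [LocallyCompactSpace X] [MeasurableSpace X] [BorelSpace X]

/-- A locally compact group carrying a positive continuous integrable function is σ-compact. -/
theorem sigmaCompactSpace_of_integrable_pos (m : Measure X) [m.IsOpenPosMeasure] {u : X → ℝ}
    (hu : Continuous u) (hpos : ∀ x, 0 < u x) (hint : Integrable u m) : SigmaCompactSpace X := by
  obtain ⟨K, hK, hK0⟩ := exists_compact_mem_nhds (0 : X)
  have hV0 : (0 : X) ∈ interior K := mem_interior_iff_mem_nhds.2 hK0
  set B : X → Set X := fun x => (fun y => -x + y) ⁻¹' interior K with hB
  have hBo : ∀ x, IsOpen (B x) := fun x => isOpen_interior.preimage (by fun_prop)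
  have hBne : ∀ x, (B x).Nonempty := fun x => ⟨x, by simpa [hB] using hV0⟩
  -- With all radii `0`, Vitali's lemma just gives a maximal disjoint family of translates. It is
  -- countable, since each member has positive mass for the finite measure `u m`.
  obtain ⟨T, -, hT, hcov⟩ := Vitali.exists_disjoint_subfamily_covering_enlargement B univ
    (fun _ => 0) 2 (by norm_num) (fun _ _ => le_rfl) 0 (fun _ _ => le_rfl) (fun x _ => hBne x)
  have hTc : T.Countable := by
    have := isFiniteMeasure_withDensity_ofReal hint.2
    have hc := Measure.countable_meas_pos_of_disjoint_iUnion
      (μ := m.withDensity fun x => ENNReal.ofReal (u x)) (As := fun x : T => B x)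
      (fun x => (hBo x).measurableSet)
      (fun x y hxy => hT x.2 y.2 (by simpa [Subtype.ext_iff] using hxy))
    have hall : {x : T | 0 < m.withDensity (fun x => ENNReal.ofReal (u x)) (B x)} = univ := by
      refine eq_univ_of_forall fun x => ?_
      rw [mem_ofPred_eq, pos_iff_ne_zero, ne_eq,
        withDensity_apply_eq_zero (by fun_prop)]
      simpa [hpos] using ((hBo x).measure_pos m (hBne x)).ne'
    rw [hall, countable_univ_iff] at hc
    exact hc
  refine SigmaCompactSpace.of_countable ((fun x => (fun y => x + y) '' (K - K)) '' T)
    (hTc.image _) (forall_mem_image.2 fun x _ => (sub_eq_add_neg K K ▸ hK.add hK.neg).image (by fun_prop)) ?_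
  refine eq_univ_of_forall fun g => ?_
  obtain ⟨x, hx, ⟨y, hyg, hyx⟩, -⟩ := hcov g (mem_univ g)
  refine ⟨_, mem_image_of_mem _ hx, -x + g, ⟨-x + y, interior_subset hyx, -g + y,
    interior_subset hyg, show -x + y - (-g + y) = -x + g by abel⟩, by simp⟩

end SigmaCompact

theorem subset_preimage_iteratedSum_succ {X : Type*} [AddCommGroup X] {K : Set X} {n : ℕ} {h : X} (hh : h ∈ iteratedSum K n) :
    K ⊆ (fun t => t + h) ⁻¹' iteratedSum K (n + 1) := fun t ht =>
  ⟨h, hh, t, ht, add_comm h t⟩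

/-- A σ-compact locally compact group is exhausted by closed compact neighbourhoods of `0`. -/
theorem exists_aecover_compact {X : Type*} [AddCommGroup X] [TopologicalSpace X]
    [IsTopologicalAddGroup X] [MeasurableSpace X] [BorelSpace X] [LocallyCompactSpace X]
    [SigmaCompactSpace X] (m : Measure X) :
    ∃ K : ℕ → Set X, AECover m atTop K ∧ ∀ n, IsCompact (K n) ∧ IsClosed (K n) ∧
      K n ∈ 𝓝 (0 : X) := by
  obtain ⟨L, hL, hL0⟩ := exists_compact_mem_nhds (0 : X)
  let C : CompactExhaustion X := default
  have hc : ∀ n, IsClosed (closure (C n ∪ L)) := fun n => isClosed_closure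
  -- `L` makes each set a neighbourhood of `0`; the closure is needed as the space need not be
  -- Hausdorff.
  refine ⟨fun n => closure (C n ∪ L), ⟨?_, fun n => (hc n).measurableSet⟩, fun n =>
    ⟨((C.isCompact n).union hL).closure, hc n,
      mem_of_superset hL0 (subset_union_right.trans subset_closure)⟩⟩
  refine Eventually.of_forall fun x => ?_
  obtain ⟨n, hn⟩ := C.exists_mem x
  filter_upwards [eventually_ge_atTop n] with k hk
  exact subset_closure (Or.inl (C.subset hk hn))

/-! ### Averaging over Følner sets -/

section Averaging

variable {X E : Type*} [AddCommGroup X] [TopologicalSpace X] [IsTopologicalAddGroup X]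
  [MeasurableSpace X] [BorelSpace X] (m : Measure X) [m.IsAddHaarMeasure]
  [NormedAddCommGroup E] [InnerProductSpace ℂ E] [CompleteSpace E]

theorem setIntegral_sub_right_eq {F : Type*} [NormedAddCommGroup F] [NormedSpace ℝ F] (P : X → F)
    (A : Set X) (h : X) :
    ∫ k in A, P (k - h) ∂m = ∫ t in (fun t => t + h) ⁻¹' A, P t ∂m := by
  have := (measurePreserving_add_right m h).setIntegral_preimage_emb
    (measurableEmbedding_addRight h) (fun k => P (k - h)) A
  simpa using this.symm

/-- If `p` and `q` are nonnegative coefficients such that `q` is dominated by `p` in the sense of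
Cauchy-Schwarz, then the integrals of `q` over compact sets are bounded by the integral of `p`. -/
theorem setIntegral_le_of_inner {φ ψ : X → E} (hφ : Continuous φ) (hψ : Continuous ψ)
    {p q : X → ℝ} (hφφ : ∀ h k, inner ℂ (φ h) (φ k) = p (k - h))
    (hψψ : ∀ h k, inner ℂ (ψ h) (ψ k) = p (k - h))
    (hφψ : ∀ h k, inner ℂ (φ h) (ψ k) = q (k - h)) (hq : Continuous q)
    (hp0 : ∀ x, 0 ≤ p x) (hq0 : ∀ x, 0 ≤ q x) (hpi : Integrable p m)
    {K : Set X} (hK : IsCompact K) (hKc : IsClosed K) (hK0 : K ∈ 𝓝 (0 : X)) :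
    ∫ t in K, q t ∂m ≤ 2 * ∫ t, p t ∂m := by
  -- Taking `ε = 1` produces the constant `2`.
  obtain ⟨n, hn⟩ := exists_measure_iteratedSum_succ_le m hK hK0 one_pos
  set B := iteratedSum K n with hB
  set A := iteratedSum K (n + 1) with hA
  have hAk : IsCompact A := isCompact_iteratedSum hK _
  have hAc : IsClosed A := isClosed_iteratedSum hK hKc _
  have hBc : IsClosed B := isClosed_iteratedSum hK hKc _
  have hBA : B ⊆ A := iteratedSum_subset_succ (mem_of_mem_nhds hK0) n
  have hBpos : 0 < m.real B := measure_iteratedSum_pos m hK hK0 n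
  have hnorm : ∀ χ : X → E, Continuous χ → (∀ h k, inner ℂ (χ h) (χ k) = (p (k - h) : ℂ)) →
      ‖∫ h in A, χ h ∂m‖ ^ 2 ≤ m.real A * ∫ t, p t ∂m := by
    intro χ hχ hχχ
    obtain ⟨h1, h2⟩ := inner_setIntegral_setIntegral m hχ hχ hAk hAc
    rw [inner_self_eq_norm_sq_to_K] at h1
    simp only [hχχ, integral_complex_ofReal] at h1 h2
    have h1' : ‖∫ h in A, χ h ∂m‖ ^ 2 = ∫ h in A, ∫ k in A, p (k - h) ∂m ∂m := by
      exact Complex.ofReal_injective (by simpa using h1)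
    have h2' : IntegrableOn (fun h => ∫ k in A, p (k - h) ∂m) A m := by
      simpa [IntegrableOn] using h2.re
    rw [h1', ← smul_eq_mul, ← setIntegral_const]
    refine setIntegral_mono h2' (integrableOn_const hAk.measure_ne_top) fun h => ?_
    dsimp only
    rw [setIntegral_sub_right_eq]
    exact setIntegral_le_integral hpi (Eventually.of_forall hp0)
  -- For `h ∈ B` the translate `A - h` contains `K`.
  have hlow : m.real B * ∫ t in K, q t ∂m ≤ ‖∫ h in A, φ h ∂m‖ * ‖∫ h in A, ψ h ∂m‖ := by
    obtain ⟨h1, h2⟩ := inner_setIntegral_setIntegral m hφ hψ hAk hAc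
    simp only [hφψ, integral_complex_ofReal] at h1 h2
    have h2' : IntegrableOn (fun h => ∫ k in A, q (k - h) ∂m) A m := by
      simpa [IntegrableOn] using h2.re
    have hre : RCLike.re (inner ℂ (∫ h in A, φ h ∂m) (∫ h in A, ψ h ∂m)) =
        ∫ h in A, ∫ k in A, q (k - h) ∂m ∂m := by
      rw [h1]; simp
    refine le_trans ?_ ((hre.symm.le).trans (re_inner_le_norm _ _))
    calc m.real B * ∫ t in K, q t ∂m = ∫ h in B, ∫ t in K, q t ∂m ∂m := by
          rw [setIntegral_const, smul_eq_mul]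
      _ ≤ ∫ h in B, ∫ k in A, q (k - h) ∂m ∂m := by
          refine setIntegral_mono_on (integrableOn_const
            (isCompact_iteratedSum hK n).measure_ne_top) (h2'.mono_set hBA) hBc.measurableSet
            fun h hh => ?_
          rw [setIntegral_sub_right_eq]
          have hcl : IsClosed ((fun t => t + h) ⁻¹' A) := hAc.preimage (by fun_prop)
          refine setIntegral_mono_set ?_ (Eventually.of_forall hq0)
            (subset_preimage_iteratedSum_succ hh).eventuallyLE
          exact hq.continuousOn.integrableOn_compact'
            ((Homeomorph.addRight h).isCompact_preimage.2 hAk) hcl.measurableSet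
      _ ≤ _ := setIntegral_mono_set h2'
          (Eventually.of_forall fun h => integral_nonneg fun k => hq0 _) hBA.eventuallyLE
  have hup := mul_le_mul_of_nonneg_right hn (integral_nonneg (μ := m) hp0)
  have h3 := hnorm φ hφ hφφ
  have h4 := hnorm ψ hψ hψψ
  refine le_of_mul_le_mul_left ?_ hBpos
  nlinarith [sq_nonneg (‖∫ h in A, φ h ∂m‖ - ‖∫ h in A, ψ h ∂m‖)]

/-- The integral of an integrable diagonal coefficient is nonnegative. -/
theorem integral_nonneg_of_inner [LocallyCompactSpace X] [SigmaCompactSpace X] {φ : X → E}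
    (hφ : Continuous φ) {P : X → ℂ} (hφφ : ∀ h k, inner ℂ (φ h) (φ k) = P (k - h))
    (hP : Integrable P m) : 0 ≤ ∫ t, P t ∂m := by
  obtain ⟨K, hcov, hK⟩ := exists_aecover_compact m
  set I := ∫ t, P t ∂m with hI
  set L := ∫ t, ‖P t‖ ∂m with hL
  have hL0 : 0 ≤ L := integral_nonneg fun _ => norm_nonneg _
  have key : ∀ ε > 0, ∃ r : ℂ, 0 ≤ r ∧ dist I r < ε := by
    intro ε hε
    set δ := ε / (2 * (L + 1)) with hδ
    have hδ0 : 0 < δ := by positivity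
    have hlim := hcov.integral_tendsto_of_countably_generated hP.norm
    obtain ⟨j, hj⟩ := (hlim.eventually (lt_mem_nhds (show L - δ < L by linarith))).exists
    obtain ⟨hKk, hKc, hK0⟩ := hK j
    obtain ⟨n, hn⟩ := exists_measure_iteratedSum_succ_le m hKk hK0 hδ0
    set B := iteratedSum (K j) n with hB
    set A := iteratedSum (K j) (n + 1) with hA
    have hAk : IsCompact A := isCompact_iteratedSum hKk _
    have hAc : IsClosed A := isClosed_iteratedSum hKk hKc _
    have hBc : IsClosed B := isClosed_iteratedSum hKk hKc _
    have hBA : B ⊆ A := iteratedSum_subset_succ (mem_of_mem_nhds hK0) n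
    have hBpos : 0 < m.real B := measure_iteratedSum_pos m hKk hK0 n
    have hApos : 0 < m.real A := measure_iteratedSum_pos m hKk hK0 (n + 1)
    obtain ⟨h1, h2⟩ := inner_setIntegral_setIntegral m hφ hφ hAk hAc
    rw [inner_self_eq_norm_sq_to_K] at h1
    simp only [hφφ] at h1 h2
    set F : X → ℂ := fun h => ∫ k in A, P (k - h) ∂m with hF
    have hdiff : ∀ h, ‖F h - I‖ ≤ ∫ t in ((fun t => t + h) ⁻¹' A)ᶜ, ‖P t‖ ∂m := by
      intro h
      have hcl : IsClosed ((fun t => t + h) ⁻¹' A) := hAc.preimage (by fun_prop)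
      rw [hF]
      dsimp only
      rw [setIntegral_sub_right_eq, hI, ← integral_add_compl hcl.measurableSet hP, sub_add_cancel_left,
        norm_neg]
      exact norm_integral_le_integral_norm _
    have hdiffL : ∀ h, ‖F h - I‖ ≤ L := fun h => (hdiff h).trans
      (setIntegral_le_integral hP.norm (Eventually.of_forall fun _ => norm_nonneg _))
    have hdiffB : ∀ h ∈ B, ‖F h - I‖ ≤ δ := by
      intro h hh
      refine (hdiff h).trans ?_
      have h5 : ∫ t in ((fun t => t + h) ⁻¹' A)ᶜ, ‖P t‖ ∂m ≤ ∫ t in (K j)ᶜ, ‖P t‖ ∂m :=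
        setIntegral_mono_set hP.norm.integrableOn (Eventually.of_forall fun _ => norm_nonneg _)
          (compl_subset_compl.2 (subset_preimage_iteratedSum_succ hh)).eventuallyLE
      have h6 := integral_add_compl hKc.measurableSet hP.norm
      linarith
    have hAint : IntegrableOn (fun h => F h - I) A m :=
      h2.sub (integrableOn_const hAk.measure_ne_top)
    have hsub : (∫ h in A, F h ∂m) - m.real A * I = ∫ h in A, (F h - I) ∂m := by
      rw [integral_sub h2 (integrableOn_const hAk.measure_ne_top), setIntegral_const]
      simp
    -- On `B` the error is at most `δ`; on `A \ B` it is at most `L`, but that set has measure at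
    -- most `δ * m B`.
    have hbound : ‖(∫ h in A, F h ∂m) - m.real A * I‖ ≤ δ * (L + 1) * m.real A := by
      rw [hsub]
      have h7 : ∫ h in A, (F h - I) ∂m = ∫ h in B, (F h - I) ∂m + ∫ h in A \ B, (F h - I) ∂m := by
        rw [← setIntegral_union disjoint_sdiff_right (hAc.measurableSet.diff hBc.measurableSet)
          (hAint.mono_set hBA) (hAint.mono_set sdiff_subset), union_sdiff_cancel hBA]
      have hBf : m B < ⊤ := (isCompact_iteratedSum hKk n).measure_lt_top
      have h8 : ‖∫ h in B, (F h - I) ∂m‖ ≤ δ * m.real B :=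
        norm_setIntegral_le_of_norm_le_const hBf hdiffB
      have h9 : ‖∫ h in A \ B, (F h - I) ∂m‖ ≤ L * m.real (A \ B) :=
        norm_setIntegral_le_of_norm_le_const
          ((measure_mono sdiff_subset).trans_lt hAk.measure_lt_top) fun h _ => hdiffL h
      have h10 : m.real (A \ B) = m.real A - m.real B :=
        measureReal_sdiff hBA hBc.measurableSet hAk.measure_ne_top
      have h11 : m.real B ≤ m.real A := measureReal_mono hBA hAk.measure_ne_top
      rw [h7]
      refine (norm_add_le _ _).trans ?_
      have h12 : L * m.real (A \ B) ≤ L * (δ * m.real A) := by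
        refine mul_le_mul_of_nonneg_left ?_ hL0
        nlinarith
      nlinarith
    refine ⟨((‖∫ h in A, φ h ∂m‖ ^ 2 / m.real A : ℝ) : ℂ), by
      exact_mod_cast (by positivity), ?_⟩
    have hr : ((‖∫ h in A, φ h ∂m‖ ^ 2 / m.real A : ℝ) : ℂ) = (∫ h in A, F h ∂m) / m.real A := by
      rw [← h1]; push_cast; rfl
    have hA0 : (m.real A : ℂ) ≠ 0 := by exact_mod_cast hApos.ne'
    rw [hr, dist_comm, dist_eq_norm, div_sub' hA0, norm_div, Complex.norm_of_nonneg hApos.le,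
      div_lt_iff₀ hApos]
    refine hbound.trans_lt (mul_lt_mul_of_pos_right ?_ hApos)
    rw [hδ]
    field_simp
    linarith
  have hmem : I ∈ closure {r : ℂ | 0 ≤ r} := Metric.mem_closure_iff.2 fun ε hε => key ε hε
  have hcl : IsClosed {r : ℂ | 0 ≤ r} := isClosed_Ici
  rwa [hcl.closure_eq] at hmem

end Averaging

/-! ### Integrals over cosets -/

theorem cosetAverage_mk {G : Type*} [AddCommGroup G] [TopologicalSpace G] [IsTopologicalAddGroup G]
    [MeasurableSpace G] [BorelSpace G] (H : AddSubgroup G) (m : Measure H) [m.IsAddHaarMeasure]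
    (u : G → ℝ) (x : G) :
    cosetAverage H m u (x : G ⧸ H) = (∫ y : H, u (x + y) ∂m) / ∫ y : H, u y ∂m := rfl

section CosetIntegral

variable {G : Type*} [AddCommGroup G] [TopologicalSpace G] [IsTopologicalAddGroup G]
  [MeasurableSpace G] [BorelSpace G] (H : AddSubgroup G) [LocallyCompactSpace H]
  [SigmaCompactSpace H] (m : Measure H) [m.IsAddHaarMeasure] {u : G → ℝ}

/-- A nonnegative continuous positive-definite function which is integrable over a subgroup is
integrable over all of its cosets. -/
theorem IsPositiveDefinite.integrable_coset (hu : IsPositiveDefinite fun x => (u x : ℂ))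
    (huc : Continuous u) (hu0 : ∀ x, 0 ≤ u x) (hint : Integrable (fun y : H => u y) m) (x : G) :
    Integrable (fun y : H => u (x + y)) m := by
  obtain ⟨E, _, _, _, e, he, hin⟩ := hu.exists_continuous_inner (by fun_prop)
  obtain ⟨K, hcov, hK⟩ := exists_aecover_compact m
  have hc : Continuous fun y : H => u (x + y) := by fun_prop
  refine hcov.integrable_of_integral_norm_bounded (2 * ∫ y : H, u y ∂m)
    (fun n => hc.continuousOn.integrableOn_compact' (hK n).1 (hK n).2.1.measurableSet)
    (Eventually.of_forall fun n => ?_)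
  simp only [Real.norm_of_nonneg (hu0 _)]
  refine setIntegral_le_of_inner m (φ := fun h : H => e h) (ψ := fun h : H => e (x + h))
    (p := fun y : H => u y) (q := fun y : H => u (x + y)) (by fun_prop) (by fun_prop)
    ?_ ?_ ?_ hc (fun _ => hu0 _) (fun _ => hu0 _) hint (hK n).1 (hK n).2.1 (hK n).2.2
  · intro h k
    simp [hin]
  · intro h k
    simp [hin]
  · intro h k
    simp [hin, add_sub_assoc]

/-- The quadratic form attached to the coset integrals of a positive-definite function is
nonnegative. -/
theorem IsPositiveDefinite.sum_integral_coset_nonneg (hu : IsPositiveDefinite fun x => (u x : ℂ))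
    (huc : Continuous u) (hint : ∀ x, Integrable (fun y : H => u (x + y)) m) {n : ℕ}
    (x : Fin n → G) (c : Fin n → ℂ) :
    0 ≤ ∑ i, ∑ j, star (c i) * ((∫ y : H, u (x j - x i + y) ∂m : ℝ) : ℂ) * c j := by
  obtain ⟨E, _, _, _, e, he, hin⟩ := hu.exists_continuous_inner (by fun_prop)
  have hterm : ∀ i j, Integrable
      (fun t : H => star (c i) * (u (x j - x i + t) : ℂ) * c j) m := fun i j =>
    ((hint (x j - x i)).ofReal.const_mul _).mul_const _
  have h := integral_nonneg_of_inner m (φ := fun h : H => ∑ i, c i • e (x i + h))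
    (P := fun t : H => ∑ i, ∑ j, star (c i) * (u (x j - x i + t) : ℂ) * c j) (by fun_prop) ?_
    (integrable_finsetSum _ fun i _ => integrable_finsetSum _ fun j _ => hterm i j)
  · rw [integral_finsetSum _ fun i _ => integrable_finsetSum _ fun j _ => hterm i j] at h
    refine h.trans_eq (Finset.sum_congr rfl fun i _ => ?_)
    rw [integral_finsetSum _ fun j _ => hterm i j]
    refine Finset.sum_congr rfl fun j _ => ?_
    rw [integral_mul_const, integral_const_mul, integral_complex_ofReal]
  · intro h k
    simp only [sum_inner, inner_sum, inner_smul_left, inner_smul_right, hin, Finset.mul_sum]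
    rw [Finset.sum_comm]
    refine Finset.sum_congr rfl fun i _ => Finset.sum_congr rfl fun j _ => ?_
    have : x j + (k : G) - (x i + h) = x j - x i + ((k - h : H) : G) := by
      push_cast; abel
    rw [this, RCLike.star_def]
    ring

/-- The quadratic form at the points `0, x` with coefficients `1, i` is real; its imaginary part is
the difference of the two sides. -/
theorem IsPositiveDefinite.integral_coset_neg (hu : IsPositiveDefinite fun x => (u x : ℂ))
    (huc : Continuous u) (hint : ∀ x, Integrable (fun y : H => u (x + y)) m) (x : G) :
    ∫ y : H, u (-x + y) ∂m = ∫ y : H, u (x + y) ∂m := by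
  have h := (Complex.le_def.1
    (hu.sum_integral_coset_nonneg H m huc hint ![0, x] ![1, Complex.I])).2
  simp [Fin.sum_univ_two] at h
  linarith

end CosetIntegral

/-! ### The quotient ghost-space -/

theorem proposition3p2 {G : Type*} [AddCommGroup G] [TopologicalSpace G]
    [IsTopologicalAddGroup G] [LocallyCompactSpace G] [MeasurableSpace G] [BorelSpace G]
    (H : AddSubgroup G) (hH : IsClosed (H : Set G)) (S : GhostSpace G)
    (mG : Measure G) [mG.IsAddHaarMeasure] (mH : Measure H) [mH.IsAddHaarMeasure]
    (hintG : Integrable S.weight mG) (hintH : Integrable (fun y : H => S.weight y) mH) :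
    (∀ x : G, Integrable (fun y : H => S.weight (x + y)) mH) ∧
    (Continuous (cosetAverage H mH S.weight) →
      IsPositiveDefinite (fun q : G ⧸ H => (cosetAverage H mH S.weight q : ℂ)) ∧
      ∃ Q : GhostSpace (G ⧸ H), Q.weight = cosetAverage H mH S.weight) := by
  have hu := S.posDef_weight
  have huc := S.continuous_weight
  have : LocallyCompactSpace H := hH.isClosedEmbedding_subtypeVal.locallyCompactSpace
  have : SigmaCompactSpace H := sigmaCompactSpace_of_integrable_pos mH
    (huc.comp continuous_subtype_val) (fun y => S.weight_pos y) hintH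
  have hint := hu.integrable_coset H mH huc (fun x => (S.weight_pos x).le) hintH
  have hpos : ∀ x : G, 0 < ∫ y : H, S.weight (x + y) ∂mH := fun x =>
    integral_pos_of_integrable_nonneg_nonzero (x := 0)
      (huc.comp (by fun_prop : Continuous fun y : H => x + (y : G))) (hint x)
      (fun y => (S.weight_pos _).le) (S.weight_pos _).ne'
  have hpos0 : 0 < ∫ y : H, S.weight y ∂mH := by simpa using hpos 0
  have hneg : ∀ q, cosetAverage H mH S.weight (-q) = cosetAverage H mH S.weight q := by
    intro q
    induction q using QuotientAddGroup.induction_on with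
    | H x => rw [← QuotientAddGroup.mk_neg, cosetAverage_mk, cosetAverage_mk,
        hu.integral_coset_neg H mH huc hint]
  have hpd : IsPositiveDefinite fun q : G ⧸ H => (cosetAverage H mH S.weight q : ℂ) := by
    intro n q
    choose x hx using fun i => QuotientAddGroup.mk_surjective (s := H) (q i)
    obtain rfl : (fun i => (x i : G ⧸ H)) = q := funext hx
    refine .of_dotProduct_mulVec_nonneg ?_ fun c => ?_
    · ext i j
      rw [Matrix.conjTranspose_apply, Matrix.of_apply, Matrix.of_apply, RCLike.star_def,
        Complex.conj_ofReal, ← neg_sub, hneg]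
    · have h := mul_nonneg (hu.sum_integral_coset_nonneg H mH huc hint x c)
        (show (0 : ℂ) ≤ ((∫ y : H, S.weight y ∂mH : ℝ) : ℂ)⁻¹ by exact_mod_cast (by positivity))
      refine h.trans_eq ?_
      simp only [dotProduct, Matrix.mulVec, Matrix.of_apply, Pi.star_apply, Finset.mul_sum,
        Finset.sum_mul, ← QuotientAddGroup.mk_sub, cosetAverage_mk]
      refine Finset.sum_congr rfl fun i _ => Finset.sum_congr rfl fun j _ => ?_
      push_cast
      ring
  refine ⟨hint, fun hc => ⟨hpd, ⟨{
    weight := cosetAverage H mH S.weight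
    continuous_weight := hc
    weight_pos := fun q => ?_
    weight_neg := hneg
    weight_zero := ?_
    posDef_weight := hpd
    conv := fun x y => ENNReal.ofReal (cosetAverage H mH S.weight x * cosetAverage H mH S.weight y /
      cosetAverage H mH S.weight (x + y)) • @Measure.dirac (G ⧸ H) (borel (G ⧸ H)) (x + y)
    conv_eq := fun _ _ => rfl }, rfl⟩⟩⟩
  · induction q using QuotientAddGroup.induction_on with
    | H x => exact div_pos (hpos x) hpos0
  · rw [← QuotientAddGroup.mk_zero, cosetAverage_mk]
    simp [hpos0.ne']
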